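/- Let $\mathbb{R}^\infty$ be the set of all finite tuples of real numbers. A *BSS program* is a finite list of instructions, labelled $0,\dots,N-1$, acting on cells $Z_0,Z_1,\dots$ that hold real numbers and on index registers $I_0,I_1,\dots$ that hold natural numbers. The instructions are: $Z_s:=\alpha$ ($\alpha\in\mathbb{R}$ a parameter of the program); $Z_s:=Z_k\circ Z_l$ with $\circ\in\{+,-,\cdot,/\}$ (a division by $0$ is undefined, and the machine then runs forever without halting); $Z_s:=Z_k$; $Z_{I_a}:=Z_{I_b}$; $I_a:=0$; $I_a:=I_a+1$; and conditional jumps, to either of two given labels, on the tests $I_a=I_b$, $Z_k=0$, $Z_k<0$, $Z_k>0$. After an instruction other than a jump, the instruction with the next label is executed. On input $(x_0,\dots,x_{n-1})\in\mathbb{R}^\infty$ the machine starts at label $0$ with $Z_i=x_i$ for $i<n$, $I_0=n$, and $0$ everywhere else. It halts when it reaches a label that carries no instruction, and its output is then $(Z_0,\dots,Z_{I_0-1})$. An *oracle BSS program* may in addition use oracle instructions, which jump to one of two given labels according to whether $(Z_0,\dots,Z_{I_0-1})$ lies in the oracle set $A\subseteq\mathbb{R}^\infty$ or not. For $A,B\subseteq\mathbb{R}^\infty$,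 $B$ is *BSS-reducible* to $A$, written $B\le_{BSS}A$, if some oracle BSS program with oracle $A$ computes the characteristic function of $B$, that is, on every input $x\in\mathbb{R}^\infty$ it halts with output $(1)$ if $x\in B$ and with output $(0)$ if $x\notin B$. Code each instruction as a tuple of reals, consisting of a tag for its type followed by its arguments (cell numbers, index register numbers, labels, parameters), and code a (non-oracle) BSS program as the tuple that consists of the number of its instructions followed by the codes of its instructions. The *BSS halting problem* $\mathbb{H}\subseteq\mathbb{R}^\infty$ is the set of all tuples $\langle \vec p,\vec x\rangle$ (concatenation) such that $\vec p$ is the code of a BSS program that halts on input $\vec x\in\mathbb{R}^\infty$. **Theorem.** If $C\subseteq\mathbb{R}^\infty$ is a set such that $\mathbb{H}\le_{BSS}C$, then $|C|=2^{\omega}$. In particular, $\mathbb{H}\not\le_{BSS}C$ for every countable $C\subseteq\mathbb{R}^\infty$. -/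

import Mathlib

namespace BSS

/-- The set `ℝ^∞` of all finite tuples of real numbers (the empty tuple included). -/
abbrev Tuple : Type := List ℝ

/-- A configuration of a BSS machine: the label of the next instruction, the natural-number
index registers `I₀, I₁, …` (used only as addresses of cells), and the real contents of the
cells `Z₀, Z₁, …`. -/
structure Config where
  pc : ℕ
  idx : ℕ → ℕ
  cell : ℕ → ℝ

namespace Config

/-- Write the real number `v` into the cell `Z_s` and go on to the next instruction. -/
def setCell (c : Config) (s : ℕ) (v : ℝ) : Config :=
  { pc := c.pc + 1, idx := c.idx, cell := Function.update c.cell s v }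

/-- Write `n` into the index register `I_a` and go on to the next instruction. -/
def setIdx (c : Config) (a n : ℕ) : Config :=
  { pc := c.pc + 1, idx := Function.update c.idx a n, cell := c.cell }

/-- Go to the instruction with label `l`. -/
def goto (c : Config) (l : ℕ) : Config :=
  { pc := l, idx := c.idx, cell := c.cell }

/-- The tuple `(Z₀, …, Z_{n-1})` with `n = I₀`: the output of a halting computation, and the
tuple about which an oracle is asked. -/
def tuple (c : Config) : Tuple :=
  (List.range (c.idx 0)).map c.cell

/-- The initial configuration on the input `x = (x₀, …, x_{n-1})`: `Z_i = x_i` for `i < n`,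
all other cells contain `0`, `I₀ = n`, and all other index registers contain `0`. -/
def init (x : Tuple) : Config :=
  { pc := 0
    idx := fun a => if a = 0 then x.length else 0
    cell := fun i => x.getD i 0 }

end Config

/-- The instructions of a BSS machine over the ordered field `ℝ`. -/
inductive Instr where
  /-- `Z_s := α`, where `α` is a real parameter of the program -/
  | const (s : ℕ) (α : ℝ)
  /-- `Z_s := Z_k + Z_l` -/
  | add (s k l : ℕ)
  /-- `Z_s := Z_k - Z_l` -/
  | sub (s k l : ℕ)
  /-- `Z_s := Z_k * Z_l` -/
  | mul (s k l : ℕ)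
  /-- `Z_s := Z_k / Z_l`; undefined (the machine runs forever) if `Z_l = 0` -/
  | div (s k l : ℕ)
  /-- `Z_s := Z_k` -/
  | copy (s k : ℕ)
  /-- `Z_{I_a} := Z_{I_b}` -/
  | copyInd (a b : ℕ)
  /-- `I_a := 0` -/
  | idxZero (a : ℕ)
  /-- `I_a := I_a + 1` -/
  | idxSucc (a : ℕ)
  /-- if `I_a = I_b` goto `l₁` else goto `l₂` -/
  | ifIdxEq (a b l₁ l₂ : ℕ)
  /-- if `Z_k = 0` goto `l₁` else goto `l₂` -/
  | ifEq (k l₁ l₂ : ℕ)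
  /-- if `Z_k < 0` goto `l₁` else goto `l₂` -/
  | ifLt (k l₁ l₂ : ℕ)
  /-- if `Z_k > 0` goto `l₁` else goto `l₂` -/
  | ifGt (k l₁ l₂ : ℕ)

open Classical in
/-- The effect of a single instruction on a configuration. A division by zero leaves the
configuration unchanged, so that the machine attempts it again forever and never halts. -/
noncomputable def Instr.exec (c : Config) : Instr → Config
  | .const s α => c.setCell s α
  | .add s k l => c.setCell s (c.cell k + c.cell l)
  | .sub s k l => c.setCell s (c.cell k - c.cell l)
  | .mul s k l => c.setCell s (c.cell k * c.cell l)
  | .div s k l => if c.cell l = 0 then c else c.setCell s (c.cell k / c.cell l)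
  | .copy s k => c.setCell s (c.cell k)
  | .copyInd a b => c.setCell (c.idx a) (c.cell (c.idx b))
  | .idxZero a => c.setIdx a 0
  | .idxSucc a => c.setIdx a (c.idx a + 1)
  | .ifIdxEq a b l₁ l₂ => c.goto (if c.idx a = c.idx b then l₁ else l₂)
  | .ifEq k l₁ l₂ => c.goto (if c.cell k = 0 then l₁ else l₂)
  | .ifLt k l₁ l₂ => c.goto (if c.cell k < 0 then l₁ else l₂)
  | .ifGt k l₁ l₂ => c.goto (if 0 < c.cell k then l₁ else l₂)

/-- A BSS program: a finite list of instructions, labelled `0, …, N - 1`. -/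
abbrev Program : Type := List Instr

namespace Program

/-- One step of the computation of `P`; the computation stops at a label outside `P`. -/
noncomputable def step (P : Program) (c : Config) : Config :=
  match P[c.pc]? with
  | none => c
  | some i => i.exec c

/-- `P` halts on the input `x`: it reaches a label at which it has no instruction. -/
def HaltsOn (P : Program) (x : Tuple) : Prop :=
  ∃ t : ℕ, P.length ≤ ((P.step)^[t] (Config.init x)).pc

end Program

/-- The instructions of an oracle BSS machine. -/
inductive OracleInstr where
  /-- an ordinary instruction -/
  | basic (i : Instr)
  /-- if `(Z₀, …, Z_{n-1})`, where `n = I₀`, lies in the oracle goto `l₁` else goto `l₂` -/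
  | query (l₁ l₂ : ℕ)

open Classical in
/-- The effect of a single instruction of an oracle machine equipped with the oracle `A`. -/
noncomputable def OracleInstr.exec (A : Set Tuple) (c : Config) : OracleInstr → Config
  | .basic i => i.exec c
  | .query l₁ l₂ => c.goto (if c.tuple ∈ A then l₁ else l₂)

/-- An oracle BSS program: a finite list of instructions, labelled `0, …, N - 1`. -/
abbrev OracleProgram : Type := List OracleInstr

namespace OracleProgram

/-- One step of the computation of `M^A`. -/
noncomputable def step (M : OracleProgram) (A : Set Tuple) (c : Config) : Config :=
  match M[c.pc]? with
  | none => c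
  | some i => i.exec A c

/-- `M^A` halts on the input `x` with the output `y`. -/
def Outputs (M : OracleProgram) (A : Set Tuple) (x y : Tuple) : Prop :=
  ∃ t : ℕ, M.length ≤ ((M.step A)^[t] (Config.init x)).pc ∧
    ((M.step A)^[t] (Config.init x)).tuple = y

end OracleProgram

/-- `B ≤_BSS A`: some oracle BSS machine with oracle `A` computes the characteristic function
of `B` on all of `ℝ^∞`. -/
def Reducible (B A : Set Tuple) : Prop :=
  ∃ M : OracleProgram, ∀ x : Tuple,
    (x ∈ B → M.Outputs A x [1]) ∧ (x ∉ B → M.Outputs A x [0])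

/-- The code of an instruction: a tag, followed by its arguments. -/
def Instr.code : Instr → Tuple
  | .const s α => [0, (s : ℝ), α]
  | .add s k l => [1, (s : ℝ), (k : ℝ), (l : ℝ)]
  | .sub s k l => [2, (s : ℝ), (k : ℝ), (l : ℝ)]
  | .mul s k l => [3, (s : ℝ), (k : ℝ), (l : ℝ)]
  | .div s k l => [4, (s : ℝ), (k : ℝ), (l : ℝ)]
  | .copy s k => [5, (s : ℝ), (k : ℝ)]
  | .copyInd a b => [6, (a : ℝ), (b : ℝ)]
  | .idxZero a => [7, (a : ℝ)]
  | .idxSucc a => [8, (a : ℝ)]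
  | .ifIdxEq a b l₁ l₂ => [9, (a : ℝ), (b : ℝ), (l₁ : ℝ), (l₂ : ℝ)]
  | .ifEq k l₁ l₂ => [10, (k : ℝ), (l₁ : ℝ), (l₂ : ℝ)]
  | .ifLt k l₁ l₂ => [11, (k : ℝ), (l₁ : ℝ), (l₂ : ℝ)]
  | .ifGt k l₁ l₂ => [12, (k : ℝ), (l₁ : ℝ), (l₂ : ℝ)]

/-- The code of a program: the number of its instructions, followed by their codes. -/
def Program.code (P : Program) : Tuple :=
  (P.length : ℝ) :: P.flatMap Instr.code

/-- The BSS halting problem `ℍ`: all tuples `⟨p, x⟩`, the code `p` of a BSS program followed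
by a finite tuple `x`, such that the program halts on the input `x`. -/
def haltingProblem : Set Tuple :=
  {w | ∃ (P : Program) (x : Tuple), P.HaltsOn x ∧ w = P.code ++ x}

theorem Instr.code_append_inj {i j : Instr} {x y : Tuple}
    (h : i.code ++ x = j.code ++ y) : i = j ∧ x = y := by
  cases i <;> cases j <;> simp [Instr.code] at h <;> simp_all

/-- A tuple `⟨p, x⟩` determines both the program and the input. -/
theorem Program.code_append_inj {P Q : Program} {x y : Tuple}
    (h : P.code ++ x = Q.code ++ y) : P = Q ∧ x = y := by
  simp only [Program.code, List.cons_append, List.cons.injEq, Nat.cast_inj] at h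
  obtain ⟨hl, h⟩ := h
  induction P generalizing Q with
  | nil =>
    cases Q with
    | nil => simpa using h
    | cons j Q => simp at hl
  | cons i P ih =>
    cases Q with
    | nil => simp at hl
    | cons j Q =>
      simp only [List.flatMap_cons, List.append_assoc] at h
      obtain ⟨rfl, h'⟩ := Instr.code_append_inj h
      obtain ⟨rfl, rfl⟩ := ih (by simpa using hl) h'
      exact ⟨rfl, rfl⟩

end BSS

namespace BSS

open Polynomial Filter Topology

/-! Suppose `M` decides the halting problem with an oracle `A` of fewer than continuum many tuples.
The parameters of `M` and the entries of the tuples in `A` generate a field `K` that is still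
smaller than the continuum, so there are `y`, `x` in `(-2, 2)` with `y` transcendental over `K` and
`x` transcendental over `K(y)`. Consider the program that, on input `(y, u)`, iterates `f(w) = w ^ 2
- 2` from `u` until it meets `y`. It does not halt on `(y, x)`. But `f` is angle doubling in the
coordinate `2 cos θ`, so there are real `u n → x` whose `n`-th iterate is `y`, and the program halts
on each `(y, u n)`.

`M` cannot see the difference. After `t` steps on `(y, u)` its cells are rational functions of `u`
over `K(y)`. As `u n` has degree at least `2 ^ n` over `K(y)` (`evalPair_ne_zero`), any bound on
degrees is eventually exceeded: zero tests come out as at `x`, and order tests do so by continuity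
(`sign_cases`). A cell that is not constantly an element of `K` eventually avoids `K`, so oracle
answers also agree (`const_or_notMem`, `tuple_mem`). Hence the answer `(0)` at `x` recurs at some `u
n`, where it is wrong. -/

/-- Evaluation of a polynomial in two variables over `K` at the pair `(y, u)`; the coefficients
are evaluated at `y`. -/
noncomputable def evalPair (K : Subfield ℝ) (y u : ℝ) : K[X][X] →+* ℝ :=
  eval₂RingHom (aeval y : K[X] →ₐ[K] ℝ).toRingHom u

/-! ### Rational functions along a generic filter -/

section Rational

variable {K : Subfield ℝ} {y x : ℝ} {L : Filter ℝ}

theorem evalPair_const (k : K) (u : ℝ) : evalPair K y u (C (C k)) = k := by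
  simp [evalPair]; rfl

theorem evalPair_C_X (u : ℝ) : evalPair K y u (C X) = y := by
  simp [evalPair]

theorem evalPair_X (u : ℝ) : evalPair K y u X = u := by
  simp [evalPair]

theorem continuous_evalPair (p : K[X][X]) : Continuous fun u => evalPair K y u p := by
  simp only [evalPair, coe_eval₂RingHom, eval₂_eq_eval_map]
  exact Polynomial.continuous _

/-- Along `L`, the points `u` converge to `x`, and they eventually avoid the zeros of all nonzero
polynomials of bounded degree with coefficients in `K[y]`. -/
structure GenericAlong (K : Subfield ℝ) (y x : ℝ) (L : Filter ℝ) : Prop where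
  pure_le : pure x ≤ L
  le_nhds : L ≤ 𝓝 x
  ne_zero : ∀ d : ℕ, ∀ᶠ u in L, ∀ p : K[X][X], p ≠ 0 → p.natDegree ≤ d → evalPair K y u p ≠ 0

theorem GenericAlong.eventually_ne (h : GenericAlong K y x L) {p : K[X][X]} (hp : p ≠ 0) :
    ∀ᶠ u in L, evalPair K y u p ≠ 0 :=
  (h.ne_zero p.natDegree).mono fun _ hu => hu p hp le_rfl

/-- Along `L`, the function `g` is a rational function with coefficients in `K[y]`. -/
def RationalAlong (K : Subfield ℝ) (y : ℝ) (L : Filter ℝ) (g : ℝ → ℝ) : Prop :=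
  ∃ p q : K[X][X], q ≠ 0 ∧ ∀ᶠ u in L, g u = evalPair K y u p / evalPair K y u q

namespace RationalAlong

theorem congr {g h : ℝ → ℝ} (hg : RationalAlong K y L g) (hgh : ∀ᶠ u in L, h u = g u) :
    RationalAlong K y L h := by
  obtain ⟨p, q, hq, hpq⟩ := hg
  exact ⟨p, q, hq, by filter_upwards [hpq, hgh] with u h₁ h₂ using h₂.trans h₁⟩

theorem of_polynomial (p : K[X][X]) : RationalAlong K y L fun u => evalPair K y u p :=
  ⟨p, 1, one_ne_zero, by simp⟩

theorem const {a : ℝ} (ha : a ∈ K) : RationalAlong K y L fun _ => a :=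
  (of_polynomial (C (C ⟨a, ha⟩))).congr (by simp [evalPair_const])

theorem const_self : RationalAlong K y L fun _ => y :=
  (of_polynomial (C X)).congr (by simp [evalPair_C_X])

theorem id : RationalAlong K y L fun u => u :=
  (of_polynomial X).congr (by simp [evalPair_X])

variable {g h : ℝ → ℝ}

theorem add (hL : GenericAlong K y x L) (hg : RationalAlong K y L g)
    (hh : RationalAlong K y L h) : RationalAlong K y L fun u => g u + h u := by
  obtain ⟨p, q, hq, hpq⟩ := hg
  obtain ⟨r, s, hs, hrs⟩ := hh
  refine ⟨p * s + q * r, q * s, mul_ne_zero hq hs, ?_⟩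
  filter_upwards [hpq, hrs, hL.eventually_ne hq, hL.eventually_ne hs] with u h₁ h₂ h₃ h₄
  rw [h₁, h₂, div_add_div _ _ h₃ h₄]
  simp

theorem mul (hg : RationalAlong K y L g)
    (hh : RationalAlong K y L h) : RationalAlong K y L fun u => g u * h u := by
  obtain ⟨p, q, hq, hpq⟩ := hg
  obtain ⟨r, s, hs, hrs⟩ := hh
  refine ⟨p * r, q * s, mul_ne_zero hq hs, ?_⟩
  filter_upwards [hpq, hrs] with u h₁ h₂
  rw [h₁, h₂, div_mul_div_comm]
  simp

theorem sub (hL : GenericAlong K y x L) (hg : RationalAlong K y L g)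
    (hh : RationalAlong K y L h) : RationalAlong K y L fun u => g u - h u :=
  (hg.add hL ((const (neg_mem (one_mem K))).mul hh)).congr
    (Eventually.of_forall fun u => by ring)

theorem div (hg : RationalAlong K y L g)
    (hh : RationalAlong K y L h) : RationalAlong K y L fun u => g u / h u := by
  obtain ⟨p, q, hq, hpq⟩ := hg
  obtain ⟨r, s, hs, hrs⟩ := hh
  by_cases hr : r = 0
  -- Here `h` vanishes eventually, so Lean's quotient `g / h` is eventually `0`.
  · refine (const (zero_mem K)).congr ?_
    filter_upwards [hrs] with u h₂
    simp [h₂, hr]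
  · refine ⟨p * s, q * r, mul_ne_zero hq hr, ?_⟩
    filter_upwards [hpq, hrs] with u h₁ h₂
    rw [h₁, h₂, div_div_div_eq]
    simp

/-- A rational function has an eventually constant sign. -/
theorem sign_cases (hL : GenericAlong K y x L) (hg : RationalAlong K y L g) :
    (∀ᶠ u in L, g u = 0) ∨ (∀ᶠ u in L, g u < 0) ∨ ∀ᶠ u in L, 0 < g u := by
  obtain ⟨p, q, hq, hpq⟩ := hg
  by_cases hp : p = 0
  · left
    filter_upwards [hpq] with u h₁
    simp [h₁, hp]
  right
  -- An eventual property holds at `x` itself, so the quotient is continuous there with a nonzero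
  -- value.
  have hqx : evalPair K y x q ≠ 0 := hL.pure_le (hL.eventually_ne hq)
  have hpx : evalPair K y x p ≠ 0 := hL.pure_le (hL.eventually_ne hp)
  have hc : Tendsto (fun u => evalPair K y u p / evalPair K y u q) L
      (𝓝 (evalPair K y x p / evalPair K y x q)) :=
    (((continuous_evalPair p).continuousAt.div
      (continuous_evalPair q).continuousAt hqx).tendsto).mono_left hL.le_nhds
  rcases (div_ne_zero hpx hqx).lt_or_gt with h | h
  · left
    filter_upwards [hpq, hc.eventually_lt_const h] with u h₁ h₂ using h₁ ▸ h₂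
  · right
    filter_upwards [hpq, hc.eventually_const_lt h] with u h₁ h₂ using h₁ ▸ h₂

/-- A rational function is eventually a constant from `K`, or eventually takes no value
in `K`. -/
theorem const_or_notMem (hL : GenericAlong K y x L) (hg : RationalAlong K y L g) :
    (∃ k ∈ K, ∀ᶠ u in L, g u = k) ∨ ∀ᶠ u in L, g u ∉ K := by
  obtain ⟨p, q, hq, hpq⟩ := hg
  by_cases hk : ∃ k : K, p = C (C k) * q
  · obtain ⟨k, hk⟩ := hk
    left
    refine ⟨k, k.2, ?_⟩
    filter_upwards [hpq, hL.eventually_ne hq] with u h₁ h₂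
    rw [h₁, hk, map_mul, evalPair_const, mul_div_cancel_right₀ _ h₂]
  · right
    filter_upwards [hpq, hL.eventually_ne hq,
      hL.ne_zero (max p.natDegree q.natDegree)] with u h₁ h₂ h₃ hmem
    -- This polynomial varies with `u`; only its degree is bounded. Hence the uniformity over all
    -- `p` in `ne_zero`.
    refine h₃ (p - C (C ⟨g u, hmem⟩) * q) (fun h => hk ⟨_, sub_eq_zero.1 h⟩) ?_ ?_
    · exact (natDegree_sub_le _ _).trans (max_le_max le_rfl (natDegree_C_mul_le _ _))
    · rw [map_sub, map_mul, evalPair_const, sub_eq_zero]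
      rw [eq_div_iff h₂] at h₁
      exact h₁.symm

end RationalAlong

end Rational

/-! ### Computations along a generic filter -/

section Run

variable {K : Subfield ℝ} {y x : ℝ} {L : Filter ℝ}

/-- Along `L`, the configurations `c u` have the same label and index registers, and the contents
of their cells are rational functions of `u`. -/
structure TameAlong (K : Subfield ℝ) (y : ℝ) (L : Filter ℝ) (c : ℝ → Config) : Prop where
  pc : ∃ l, ∀ᶠ u in L, (c u).pc = l
  idx : ∀ a, ∃ n, ∀ᶠ u in L, (c u).idx a = n
  cell : ∀ i, RationalAlong K y L fun u => (c u).cell i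

namespace TameAlong

variable {c d : ℝ → Config}

theorem congr (hc : TameAlong K y L c) (h : ∀ᶠ u in L, d u = c u) : TameAlong K y L d where
  pc := by
    obtain ⟨l, hl⟩ := hc.pc
    exact ⟨l, by filter_upwards [hl, h] with u h₁ h₂; rw [h₂, h₁]⟩
  idx a := by
    obtain ⟨l, hl⟩ := hc.idx a
    exact ⟨l, by filter_upwards [hl, h] with u h₁ h₂; rw [h₂, h₁]⟩
  cell i := (hc.cell i).congr (h.mono fun u hu => by rw [hu])

theorem pc_succ (hc : TameAlong K y L c) : ∃ l, ∀ᶠ u in L, (c u).pc + 1 = l := by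
  obtain ⟨l, hl⟩ := hc.pc
  exact ⟨l + 1, hl.mono fun u hu => by rw [hu]⟩

theorem setCell (hc : TameAlong K y L c) (s : ℕ) {g : ℝ → ℝ} (hg : RationalAlong K y L g) :
    TameAlong K y L fun u => (c u).setCell s (g u) where
  pc := hc.pc_succ
  idx := hc.idx
  cell i := by
    by_cases h : i = s
    · subst h
      simpa [Config.setCell] using hg
    · simpa [Config.setCell, Function.update_of_ne h] using hc.cell i

theorem setIdx (hc : TameAlong K y L c) (a : ℕ) {m : ℝ → ℕ} (hm : ∃ n, ∀ᶠ u in L, m u = n) :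
    TameAlong K y L fun u => (c u).setIdx a (m u) where
  pc := hc.pc_succ
  idx b := by
    by_cases h : b = a
    · subst h
      simpa [Config.setIdx] using hm
    · simpa [Config.setIdx, Function.update_of_ne h] using hc.idx b
  cell := hc.cell

theorem goto (hc : TameAlong K y L c) {m : ℝ → ℕ} (hm : ∃ n, ∀ᶠ u in L, m u = n) :
    TameAlong K y L fun u => (c u).goto (m u) where
  pc := hm
  idx := hc.idx
  cell := hc.cell

theorem goto_ite (hc : TameAlong K y L c) {p : ℝ → Prop} [∀ u, Decidable (p u)] (l₁ l₂ : ℕ)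
    (hp : (∀ᶠ u in L, p u) ∨ ∀ᶠ u in L, ¬ p u) :
    TameAlong K y L fun u => (c u).goto (if p u then l₁ else l₂) :=
  hc.goto <| hp.elim (fun h => ⟨l₁, h.mono fun _ hu => if_pos hu⟩)
    fun h => ⟨l₂, h.mono fun _ hu => if_neg hu⟩

/-- Every test on a cell is a comparison with `0`, so the eventually constant sign decides each
branch, including whether a division is defined. -/
theorem instr_exec (hL : GenericAlong K y x L) (hc : TameAlong K y L c) (i : Instr)
    (hi : ∀ s α, i = .const s α → α ∈ K) : TameAlong K y L fun u => i.exec (c u) := by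
  cases i with
  | const s α => exact hc.setCell s (.const (hi s α rfl))
  | add s k l => exact hc.setCell s ((hc.cell k).add hL (hc.cell l))
  | sub s k l => exact hc.setCell s ((hc.cell k).sub hL (hc.cell l))
  | mul s k l => exact hc.setCell s ((hc.cell k).mul (hc.cell l))
  | div s k l =>
    rcases (hc.cell l).sign_cases hL with h | h | h
    · exact hc.congr (h.mono fun u hu => if_pos hu)
    · exact (hc.setCell s ((hc.cell k).div (hc.cell l))).congr (h.mono fun u hu => if_neg hu.ne)
    · exact (hc.setCell s ((hc.cell k).div (hc.cell l))).congr (h.mono fun u hu => if_neg hu.ne')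
  | copy s k => exact hc.setCell s (hc.cell k)
  | copyInd a b =>
    obtain ⟨m, hm⟩ := hc.idx a
    obtain ⟨n, hn⟩ := hc.idx b
    refine (hc.setCell m (hc.cell n)).congr ?_
    filter_upwards [hm, hn] with u h₁ h₂
    simp [Instr.exec, h₁, h₂]
  | idxZero a => exact hc.setIdx a ⟨0, by simp⟩
  | idxSucc a =>
    obtain ⟨m, hm⟩ := hc.idx a
    exact hc.setIdx a ⟨m + 1, hm.mono fun u hu => by rw [hu]⟩
  | ifIdxEq a b l₁ l₂ =>
    obtain ⟨m, hm⟩ := hc.idx a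
    obtain ⟨n, hn⟩ := hc.idx b
    refine hc.goto_ite l₁ l₂ ?_
    by_cases h : m = n
    · left
      filter_upwards [hm, hn] with u h₁ h₂
      rw [h₁, h₂, h]
    · right
      filter_upwards [hm, hn] with u h₁ h₂
      rwa [h₁, h₂]
  | ifEq k l₁ l₂ =>
    refine hc.goto_ite l₁ l₂ ?_
    rcases (hc.cell k).sign_cases hL with h | h | h
    exacts [.inl h, .inr (h.mono fun _ h => h.ne), .inr (h.mono fun _ h => h.ne')]
  | ifLt k l₁ l₂ =>
    refine hc.goto_ite l₁ l₂ ?_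
    rcases (hc.cell k).sign_cases hL with h | h | h
    exacts [.inr (h.mono fun _ h => h.not_lt), .inl h, .inr (h.mono fun _ h => h.not_gt)]
  | ifGt k l₁ l₂ =>
    refine hc.goto_ite l₁ l₂ ?_
    rcases (hc.cell k).sign_cases hL with h | h | h
    exacts [.inr (h.mono fun _ h => h.not_gt), .inr (h.mono fun _ h => h.not_gt), .inl h]

/-- The oracle answers alike along `L`, if all its tuples have their entries in `K`. -/
theorem tuple_mem (hL : GenericAlong K y x L) (hc : TameAlong K y L c) {A : Set Tuple}
    (hA : ∀ w ∈ A, ∀ a ∈ w, a ∈ K) :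
    (∀ᶠ u in L, (c u).tuple ∈ A) ∨ ∀ᶠ u in L, (c u).tuple ∉ A := by
  obtain ⟨n, hn⟩ := hc.idx 0
  -- Either one entry eventually leaves `K`, which forces the answer "no", or all entries are
  -- eventually constant and the query is a fixed tuple.
  by_cases h : ∃ i < n, ∀ᶠ u in L, (c u).cell i ∉ K
  · obtain ⟨i, hi, h⟩ := h
    right
    filter_upwards [hn, h] with u h₁ h₂ h₃
    refine h₂ (hA _ h₃ _ ?_)
    simp only [Config.tuple, h₁, List.mem_map, List.mem_range]
    exact ⟨i, hi, rfl⟩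
  · push Not at h
    have hk : ∀ i, ∃ k, i < n → ∀ᶠ u in L, (c u).cell i = k := by
      intro i
      rcases (hc.cell i).const_or_notMem hL with ⟨k, -, hk⟩ | h'
      · exact ⟨k, fun _ => hk⟩
      · exact ⟨0, fun hi => (h i hi h').elim⟩
    choose k hk using hk
    have hall : ∀ᶠ u in L, ∀ i ∈ Finset.range n, (c u).cell i = k i :=
      (Filter.eventually_all_finset _).2 fun i hi => hk i (Finset.mem_range.1 hi)
    have ht : ∀ᶠ u in L, (c u).tuple = (List.range n).map k := by
      filter_upwards [hn, hall] with u h₁ h₂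
      rw [Config.tuple, h₁]
      exact List.map_congr_left fun i hi => h₂ i (by simpa using hi)
    by_cases hmem : (List.range n).map k ∈ A
    · exact .inl (ht.mono fun u hu => hu ▸ hmem)
    · exact .inr (ht.mono fun u hu => hu ▸ hmem)

open Classical in
theorem step (hL : GenericAlong K y x L) (hc : TameAlong K y L c) {A : Set Tuple}
    (hA : ∀ w ∈ A, ∀ a ∈ w, a ∈ K) {M : OracleProgram}
    (hM : ∀ s α, .basic (.const s α) ∈ M → α ∈ K) :
    TameAlong K y L fun u => M.step A (c u) := by
  obtain ⟨l, hl⟩ := hc.pc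
  rcases h : M[l]? with _ | i
  · refine hc.congr (hl.mono fun u hu => ?_)
    simp [OracleProgram.step, hu, h]
  · suffices TameAlong K y L fun u => i.exec A (c u) from
      this.congr (hl.mono fun u hu => by simp [OracleProgram.step, hu, h])
    cases i with
    | basic i => exact hc.instr_exec hL i fun s α hi => hM s α (hi ▸ List.mem_of_getElem? h)
    | query l₁ l₂ => exact hc.goto_ite l₁ l₂ (hc.tuple_mem hL hA)

theorem iterate_step (hL : GenericAlong K y x L) (hc : TameAlong K y L c) {A : Set Tuple}
    (hA : ∀ w ∈ A, ∀ a ∈ w, a ∈ K) {M : OracleProgram}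
    (hM : ∀ s α, .basic (.const s α) ∈ M → α ∈ K) (t : ℕ) :
    TameAlong K y L fun u => (M.step A)^[t] (c u) := by
  induction t with
  | zero => exact hc
  | succ t ih => simpa only [Function.iterate_succ_apply'] using ih.step hL hA hM

end TameAlong

theorem tameAlong_init {v : Tuple} (hv : ∀ a ∈ v, a ∈ K) :
    TameAlong K y L fun u => Config.init (v ++ [y, u]) where
  pc := ⟨0, by simp [Config.init]⟩
  idx a := ⟨if a = 0 then v.length + 2 else 0, by simp [Config.init]⟩
  cell i := by
    simp only [Config.init]
    rcases lt_or_ge i v.length with h | h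
    · simp only [List.getD_append _ _ _ _ h, List.getD_eq_getElem _ _ h]
      exact .const (hv _ (List.getElem_mem h))
    · obtain ⟨j, rfl⟩ := Nat.exists_eq_add_of_le h
      simp only [List.getD_append_right _ _ _ _ h, Nat.add_sub_cancel_left]
      match j with
      | 0 => exact .const_self
      | 1 => exact .id
      | j + 2 => exact .const (zero_mem K)

namespace OracleProgram

theorem iterate_step_of_halted {M : OracleProgram} {A : Set Tuple} {c : Config}
    (h : M.length ≤ c.pc) (t : ℕ) : (M.step A)^[t] c = c :=
  Function.iterate_fixed (by simp [step, List.getElem?_eq_none h]) t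

theorem Outputs.unique {M : OracleProgram} {A : Set Tuple} {w v v' : Tuple}
    (h : M.Outputs A w v) (h' : M.Outputs A w v') : v = v' := by
  obtain ⟨t, ht, rfl⟩ := h
  obtain ⟨t', ht', rfl⟩ := h'
  rcases le_total t t' with hle | hle
  · obtain ⟨s, rfl⟩ := Nat.exists_eq_add_of_le' hle
    rw [Function.iterate_add_apply, iterate_step_of_halted ht]
  · obtain ⟨s, rfl⟩ := Nat.exists_eq_add_of_le' hle
    rw [Function.iterate_add_apply, iterate_step_of_halted ht']

/-- The output `(0)` at `x` persists along a generic filter. -/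
theorem Outputs.eventually_zero (hL : GenericAlong K y x L) {A : Set Tuple}
    (hA : ∀ w ∈ A, ∀ a ∈ w, a ∈ K) {M : OracleProgram}
    (hM : ∀ s α, .basic (.const s α) ∈ M → α ∈ K) {v : Tuple} (hv : ∀ a ∈ v, a ∈ K)
    (h : M.Outputs A (v ++ [y, x]) [0]) :
    ∀ᶠ u in L, M.Outputs A (v ++ [y, u]) [0] := by
  obtain ⟨t, ht, hout⟩ := h
  have hT := (tameAlong_init (L := L) (y := y) hv).iterate_step hL hA hM t
  obtain ⟨l, hl⟩ := hT.pc
  obtain ⟨n, hn⟩ := hT.idx 0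
  have hlx := hL.pure_le hl
  have hnx := hL.pure_le hn
  have hn1 : n = 1 := by
    rw [← (show _ = n from hnx)]
    simpa [Config.tuple] using congrArg List.length hout
  subst hn1
  have hlt : M.length ≤ l := (show _ = l from hlx) ▸ ht
  have h0x : ((M.step A)^[t] (Config.init (v ++ [y, x]))).cell 0 = 0 := by
    simpa [Config.tuple, (show _ = 1 from hnx)] using hout
  -- The sign is eventually constant and the filter sees `x`, where the cell is `0`.
  have h0 : ∀ᶠ u in L, ((M.step A)^[t] (Config.init (v ++ [y, u]))).cell 0 = 0 := by
    rcases (hT.cell 0).sign_cases hL with h | h | h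
    · exact h
    · exact absurd h0x (LT.lt.ne (hL.pure_le h))
    · exact absurd h0x (LT.lt.ne' (hL.pure_le h))
  filter_upwards [hl, hn, h0] with u h₁ h₂ h₃
  exact ⟨t, h₁ ▸ hlt, by simp [Config.tuple, h₂, h₃]⟩

end OracleProgram

end Run

/-! ### Degree bounds over `K(y)` -/

section Polynomials

/-- Substituting `g(X)` for the inner and `X` for the outer variable is injective on the
polynomials whose degree in the outer variable is less than the degree of `g`. -/
theorem eval₂_compRingHom_X_ne_zero {F : Type*} [Field F] {g : F[X]} {p : F[X][X]} (hp : p ≠ 0)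
    (hd : p.natDegree < g.natDegree) : p.eval₂ (compRingHom g) X ≠ 0 := by
  have hg : 0 < g.natDegree := by omega
  have hcomp : ∀ i ∈ p.support, (p.coeff i).comp g ≠ 0 := by
    intro i hi h
    rcases comp_eq_zero_iff.1 h with h | ⟨-, h⟩
    · exact mem_support_iff.1 hi h
    · rw [h, natDegree_C] at hg
      exact hg.false
  have hterm : ∀ i ∈ p.support, (p.coeff i).comp g * X ^ i ≠ 0 := fun i hi =>
    mul_ne_zero (hcomp i hi) (pow_ne_zero _ X_ne_zero)
  have hdeg : ∀ i ∈ p.support, ((p.coeff i).comp g * X ^ i).natDegree =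
      (p.coeff i).natDegree * g.natDegree + i := by
    intro i hi
    rw [natDegree_mul (hcomp i hi) (pow_ne_zero _ X_ne_zero), natDegree_comp, natDegree_X_pow]
  have hlt : ∀ i ∈ p.support, i < g.natDegree := fun i hi =>
    (le_natDegree_of_mem_supp i hi).trans_lt hd
  have hsum : p.eval₂ (compRingHom g) X = ∑ i ∈ p.support, (p.coeff i).comp g * X ^ i := by
    simp [eval₂_eq_sum, Polynomial.sum]
  rw [hsum, ← degree_ne_bot, degree_sum_eq_of_disjoint]
  · obtain ⟨i, hi⟩ := support_nonempty.2 hp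
    intro h
    have := Finset.le_sup (f := fun i => ((p.coeff i).comp g * X ^ i).degree) hi
    rw [h, le_bot_iff, degree_eq_bot] at this
    exact hterm i hi this
  · rintro i ⟨hi, -⟩ j ⟨hj, -⟩ hij h
    refine hij ?_
    have h' := natDegree_eq_of_degree_eq h
    rw [hdeg i hi, hdeg j hj] at h'
    -- Since `i < deg g`, the degree of the `i`-th term determines `i` modulo `deg g`, so leading
    -- terms cannot cancel.
    have := congrArg (· % g.natDegree) h'
    simpa [Nat.mod_eq_of_lt, hlt i hi, hlt j hj] using this

theorem evalPair_aeval {K : Subfield ℝ} (g : K[X]) (u : ℝ) (p : K[X][X]) :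
    evalPair K (aeval u g) u p = aeval u (p.eval₂ (compRingHom g) X) := by
  have : aeval u (p.eval₂ (compRingHom g) X) =
      (aeval u : K[X] →ₐ[K] ℝ).toRingHom (p.eval₂ (compRingHom g) X) := rfl
  rw [this, hom_eval₂]
  simp only [evalPair, coe_eval₂RingHom]
  congr 1
  · ext q <;> simp
  · simp

/-- If `y = g(u)` is transcendental over `K`, then `u` has degree at least `deg g`
over `K(y)`. -/
theorem evalPair_ne_zero {K : Subfield ℝ} {g : K[X]} {y u : ℝ} (hy : Transcendental K y)
    (hu : aeval u g = y) {p : K[X][X]} (hp : p ≠ 0) (hd : p.natDegree < g.natDegree) :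
    evalPair K y u p ≠ 0 := by
  subst hu
  rw [evalPair_aeval]
  have hu : Transcendental K u := fun h => hy <| isAlgebraic_iff_isIntegral.2 <|
    adjoin_le_integralClosure (isAlgebraic_iff_isIntegral.1 h) (aeval_mem_adjoin_singleton K u)
  exact fun h => eval₂_compRingHom_X_ne_zero hp hd (transcendental_iff.1 hu _ h)

/-- The `n`-th iterate of the polynomial `X ^ 2 - 2`. -/
noncomputable def iterPoly (K : Subfield ℝ) : ℕ → K[X]
  | 0 => X
  | n + 1 => iterPoly K n ^ 2 - C 2

theorem natDegree_iterPoly (K : Subfield ℝ) (n : ℕ) : (iterPoly K n).natDegree = 2 ^ n := by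
  induction n with
  | zero => simp [iterPoly]
  | succ n ih => rw [iterPoly, natDegree_sub_C, natDegree_pow, ih, pow_succ']

theorem aeval_iterPoly (K : Subfield ℝ) (n : ℕ) (u : ℝ) :
    aeval u (iterPoly K n) = (fun w : ℝ => w * w - 2)^[n] u := by
  induction n with
  | zero => simp [iterPoly]
  | succ n ih =>
    rw [iterPoly, Function.iterate_succ_apply', ← ih]
    rw [map_sub, sq, map_mul, aeval_C]
    rfl

end Polynomials

/-! ### Density of iterated preimages -/

theorem iterate_two_mul_cos (n : ℕ) (θ : ℝ) :
    (fun w : ℝ => w * w - 2)^[n] (2 * Real.cos θ) = 2 * Real.cos (2 ^ n * θ) := by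
  induction n with
  | zero => simp
  | succ n ih =>
    rw [Function.iterate_succ_apply', ih, pow_succ', mul_assoc 2 (2 ^ n) θ, Real.cos_two_mul]
    ring

/-- Iterated preimages under `w ↦ w ^ 2 - 2` are dense in `[-2, 2]`. -/
theorem exists_iterate_eq_abs_sub_le {x y : ℝ} (hx : x ∈ Set.Ioo (-2) 2) (hy : y ∈ Set.Ioo (-2) 2)
    (n : ℕ) : ∃ u, (fun w : ℝ => w * w - 2)^[n] u = y ∧ |u - x| ≤ 4 * Real.pi * (1 / 2) ^ n := by
  obtain ⟨θ, rfl⟩ : ∃ θ, 2 * Real.cos θ = x :=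
    ⟨Real.arccos (x / 2), by rw [Real.cos_arccos] <;> linarith [hx.1, hx.2]⟩
  obtain ⟨α, rfl⟩ : ∃ α, 2 * Real.cos α = y :=
    ⟨Real.arccos (y / 2), by rw [Real.cos_arccos] <;> linarith [hy.1, hy.2]⟩
  -- The angles `(α + 2πk) / 2 ^ n` all map to `α` modulo `2π`, at spacing `2π / 2 ^ n`; this `k`
  -- gives one within that distance of `θ`.
  set k := ⌊(2 ^ n * θ - α) / (2 * Real.pi)⌋ with hk
  have hπ := Real.pi_pos
  have h2 : (0 : ℝ) < 2 ^ n := by positivity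
  have h₁ := Int.floor_le ((2 ^ n * θ - α) / (2 * Real.pi))
  have h₂ := Int.lt_floor_add_one ((2 ^ n * θ - α) / (2 * Real.pi))
  rw [← hk, le_div_iff₀ (by positivity)] at h₁
  rw [← hk, div_lt_iff₀ (by positivity)] at h₂
  refine ⟨2 * Real.cos ((α + k * (2 * Real.pi)) / 2 ^ n), ?_, ?_⟩
  · rw [iterate_two_mul_cos, mul_div_cancel₀ _ h2.ne', Real.cos_add_int_mul_two_pi]
  · have hcos := Real.abs_cos_sub_cos_le ((α + k * (2 * Real.pi)) / 2 ^ n) θ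
    have hθ : |(α + k * (2 * Real.pi)) / 2 ^ n - θ| ≤ 2 * Real.pi * (1 / 2) ^ n := by
      rw [div_sub' h2.ne', abs_div, abs_of_pos h2, div_le_iff₀ h2, mul_assoc _ _ ((2 : ℝ) ^ n),
        ← mul_pow, abs_le]
      norm_num
      constructor <;> nlinarith
    rw [← mul_sub, abs_mul, abs_two]
    linarith

/-- A generic filter from a sequence of iterated preimages of `y` that converges to `x`. -/
theorem genericAlong_of_tendsto {K : Subfield ℝ} {y x : ℝ} {u : ℕ → ℝ} (hy : Transcendental K y)
    (hx : ∀ p : K[X][X], p ≠ 0 → evalPair K y x p ≠ 0)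
    (hu : ∀ n, (fun w : ℝ => w * w - 2)^[n] (u n) = y) (hlim : Tendsto u atTop (𝓝 x)) :
    GenericAlong K y x (pure x ⊔ map u atTop) where
  pure_le := le_sup_left
  le_nhds := sup_le (pure_le_nhds x) hlim
  ne_zero d := by
    rw [eventually_sup, eventually_pure, eventually_map]
    refine ⟨fun p hp _ => hx p hp, ?_⟩
    filter_upwards [eventually_ge_atTop d] with n hn p hp hd
    refine evalPair_ne_zero hy ((aeval_iterPoly K n _).trans (hu n)) hp ?_
    rw [natDegree_iterPoly]
    exact hd.trans_lt (hn.trans_lt n.lt_two_pow_self)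

/-! ### The orbit search program -/

section Search

/-- On input `(y, u)`, this program halts if and only if some iterate of `w ↦ w ^ 2 - 2`
maps `u` to `y`. -/
def orbitProgram : Program :=
  -- Label 6 is the exit. The last test has equal targets and serves as an unconditional jump.
  [.const 2 2, .sub 3 1 0, .ifEq 3 6 3, .mul 1 1 1, .sub 1 1 2, .ifEq 5 1 1]

theorem natCast_of_mem_code_orbitProgram {a : ℝ} (ha : a ∈ orbitProgram.code) :
    ∃ n : ℕ, a = n := by
  simp only [orbitProgram, Program.code, Instr.code, List.flatMap_cons, List.flatMap_nil,
    List.length_cons, List.length_nil, List.cons_append, List.nil_append, List.mem_cons,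
    List.not_mem_nil, or_false] at ha
  rcases ha with h | h | h | h | h | h | h | h | h | h | h | h | h | h | h | h | h | h | h | h |
    h | h | h | h
  all_goals first | exact ⟨_, h⟩ | exact ⟨OfNat.ofNat _, h.trans (by norm_cast)⟩

theorem orbitProgram_halts_of_iterate (n : ℕ) (c : Config) (hpc : c.pc = 1) (h2 : c.cell 2 = 2)
    (h : (fun w : ℝ => w * w - 2)^[n] (c.cell 1) = c.cell 0) :
    ∃ t, orbitProgram.length ≤ (orbitProgram.step^[t] c).pc := by
  obtain ⟨pc, idx, cell⟩ := c
  simp only at hpc h2 h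
  subst hpc
  by_cases h1 : cell 1 = cell 0
  · exact ⟨2, by simp [orbitProgram, Program.step, Instr.exec, Config.setCell, Config.goto, h1]⟩
  induction n generalizing cell with
  | zero => exact absurd h h1
  | succ n ih =>
    -- Five steps are one round of the loop, labels 1 to 5.
    have hstep : ∃ cell', (orbitProgram.step^[5] ⟨1, idx, cell⟩) = ⟨1, idx, cell'⟩ ∧
        cell' 0 = cell 0 ∧ cell' 1 = cell 1 * cell 1 - 2 ∧ cell' 2 = 2 := by
      refine ⟨(orbitProgram.step^[5] ⟨1, idx, cell⟩).cell, ?_, ?_⟩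
      · simp [orbitProgram, Program.step, Instr.exec, Config.setCell, Config.goto, h1, h2,
          sub_eq_zero]
      · simp [orbitProgram, Program.step, Instr.exec, Config.setCell, Config.goto, h1, h2,
          sub_eq_zero]
    obtain ⟨cell', hc, h0', h1', h2'⟩ := hstep
    suffices ∃ t, orbitProgram.length ≤ (orbitProgram.step^[t] ⟨1, idx, cell'⟩).pc by
      obtain ⟨t, ht⟩ := this
      exact ⟨t + 5, by rwa [Function.iterate_add_apply, hc]⟩
    by_cases h1'' : cell' 1 = cell' 0
    · exact ⟨2, by simp [orbitProgram, Program.step, Instr.exec, Config.setCell, Config.goto, h1'']⟩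
    · exact ih cell' h2' (by rw [h1', h0']; exact h) h1''

theorem orbitProgram_haltsOn {y u : ℝ} {n : ℕ} (h : (fun w : ℝ => w * w - 2)^[n] u = y) :
    orbitProgram.HaltsOn [y, u] := by
  obtain ⟨t, ht⟩ := orbitProgram_halts_of_iterate n
    (orbitProgram.step (Config.init [y, u]))
    (by simp [orbitProgram, Program.step, Instr.exec, Config.setCell, Config.init])
    (by simp [orbitProgram, Program.step, Instr.exec, Config.setCell, Config.init])
    (by simpa [orbitProgram, Program.step, Instr.exec, Config.setCell, Config.init] using h)
  exact ⟨t + 1, by rwa [Function.iterate_succ_apply]⟩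

theorem exists_iterate_of_haltsOn {y u : ℝ} (h : orbitProgram.HaltsOn [y, u]) :
    ∃ n, (fun w : ℝ => w * w - 2)^[n] u = y := by
  by_contra! hne
  obtain ⟨t, ht⟩ := h
  let O : ℝ → Prop := fun w => ∃ n, (fun w : ℝ => w * w - 2)^[n] u = w
  have hO : ∀ w, O w → O (w * w - 2) := by
    rintro w ⟨n, rfl⟩
    exact ⟨n + 1, Function.iterate_succ_apply' _ _ _⟩
  have hy : ¬ O y := fun ⟨n, hn⟩ => hne n hn
  -- Loop invariant: cell 1 stays in the orbit of `u`, except at label 4, where 2 is still to be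
  -- subtracted. As `y` is not in the orbit, label 6 is never reached.
  suffices H : ∀ t, ∃ pc idx cell, orbitProgram.step^[t] (Config.init [y, u]) = ⟨pc, idx, cell⟩ ∧
      cell 0 = y ∧ (pc = 0 ∧ O (cell 1) ∨ cell 2 = 2 ∧ (pc = 1 ∧ O (cell 1) ∨
        pc = 2 ∧ O (cell 1) ∧ cell 3 = cell 1 - y ∨ pc = 3 ∧ O (cell 1) ∨
        pc = 4 ∧ O (cell 1 - 2) ∨ pc = 5 ∧ O (cell 1))) by
    obtain ⟨pc, idx, cell, hc, -, hpc⟩ := H t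
    rw [hc] at ht
    simp only [orbitProgram, List.length_cons, List.length_nil] at ht
    omega
  intro t
  induction t with
  | zero =>
    exact ⟨_, _, _, rfl, by simp, .inl ⟨rfl, 0, by simp⟩⟩
  | succ t ih =>
    obtain ⟨pc, idx, cell, hc, h0, h⟩ := ih
    rw [Function.iterate_succ_apply', hc]
    rcases h with ⟨rfl, h⟩ | ⟨h2, ⟨rfl, h⟩ | ⟨rfl, h, h3⟩ | ⟨rfl, h⟩ | ⟨rfl, h⟩ | ⟨rfl, h⟩⟩ <;>
      refine ⟨_, _, _, rfl, ?_⟩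
    · simp [h0, h]
    · simp [h0, h, h2]
    · have : cell 1 - y ≠ 0 := fun h' => hy (sub_eq_zero.1 h' ▸ h)
      simp [h0, h, h2, h3, this]
    · simp [h0, h2, hO _ h]
    · simp [h0, h, h2]
    · simp [h0, h, h2]

theorem mem_haltingProblem_iff {P : Program} {v : Tuple} :
    P.code ++ v ∈ haltingProblem ↔ P.HaltsOn v := by
  constructor
  · rintro ⟨Q, w, hQ, h⟩
    obtain ⟨rfl, rfl⟩ := Program.code_append_inj h
    exact hQ
  · exact fun h => ⟨P, v, h, rfl⟩

end Search

/-! ### Cardinality and the contradiction -/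

section Cardinality

open Cardinal

/-- At most `max #R ℵ₀` reals are algebraic over `R`, too few to fill an interval. -/
theorem exists_transcendental_mem_Ioo (R : Type) [CommRing R] [IsDomain R] [Algebra R ℝ]
    [Module.IsTorsionFree R ℝ] (hR : #R < 𝔠) : ∃ y ∈ Set.Ioo (-2 : ℝ) 2, Transcendental R y := by
  by_contra! h
  have hsub : Set.Ioo (-2 : ℝ) 2 ⊆ {y | IsAlgebraic R y} := fun y hy => by
    simpa [Transcendental] using h y hy
  have h₁ := mk_le_mk_of_subset hsub
  rw [mk_Ioo_real (by norm_num)] at h₁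
  exact (h₁.trans (Algebraic.cardinalMk_le_max R ℝ)).not_gt (max_lt hR aleph0_lt_continuum)

theorem exists_generic_pair {K : Subfield ℝ} (hK : #K < 𝔠) :
    ∃ y ∈ Set.Ioo (-2 : ℝ) 2, ∃ x ∈ Set.Ioo (-2 : ℝ) 2, Transcendental K y ∧
      ∀ p : K[X][X], p ≠ 0 → evalPair K y x p ≠ 0 := by
  obtain ⟨y, hy, hyK⟩ := exists_transcendental_mem_Ioo K hK
  -- Letting `X` act as `y` makes transcendence of `x` over `K[X]` the required condition.
  let _ : Algebra K[X] ℝ := (aeval y : K[X] →ₐ[K] ℝ).toRingHom.toAlgebra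
  have : FaithfulSMul K[X] ℝ :=
    (faithfulSMul_iff_algebraMap_injective _ _).2 (transcendental_iff_injective.1 hyK)
  have hcard : #K[X] < 𝔠 :=
    (Polynomial.cardinalMk_le_max).trans_lt (max_lt hK aleph0_lt_continuum)
  obtain ⟨x, hx, hxK⟩ := exists_transcendental_mem_Ioo K[X] hcard
  exact ⟨y, hy, x, hx, hyK, fun p hp h => hp (transcendental_iff.1 hxK p h)⟩

/-- The real parameters of the program `M` and the entries of the tuples in `A` lie in a field
that is not larger than `A`. -/
theorem exists_subfield (M : OracleProgram) (A : Set Tuple) :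
    ∃ K : Subfield ℝ, #K ≤ max #A ℵ₀ ∧ (∀ w ∈ A, ∀ a ∈ w, a ∈ K) ∧
      ∀ s α, .basic (.const s α) ∈ M → α ∈ K := by
  let S : Set ℝ := (⋃ w ∈ A, {a | a ∈ w}) ∪
    ⋃ i ∈ {i | i ∈ M}, {α | ∃ s, i = .basic (.const s α)}
  have hS : #S ≤ max #A ℵ₀ := by
    refine (mk_union_le _ _).trans (add_le_of_le (le_max_right _ _) ?_ ?_)
    · refine (mk_biUnion_le _ _).trans (mul_le_of_le (le_max_right _ _) (le_max_left _ _) ?_)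
      refine ciSup_le' fun w => le_max_of_le_right ?_
      exact (List.finite_toSet w.1).countable.le_aleph0
    · refine le_max_of_le_right (Set.Countable.le_aleph0 ?_)
      refine (List.finite_toSet M).countable.biUnion fun i _ => Set.Subsingleton.countable ?_
      rintro a ⟨s, rfl⟩ b ⟨s', h⟩
      simp only [OracleInstr.basic.injEq, Instr.const.injEq] at h
      exact h.2
  refine ⟨Subfield.closure S, (Subfield.cardinalMk_closure_le_max S).trans
    (max_le hS (le_max_right _ _)), fun w hw a ha => Subfield.subset_closure (.inl ?_),
    fun s α h => Subfield.subset_closure (.inr ?_)⟩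
  · exact Set.mem_biUnion hw ha
  · exact Set.mem_biUnion (x := OracleInstr.basic (.const s α)) h ⟨s, rfl⟩

theorem continuum_le_mk_of_reducible {A : Set Tuple} (h : Reducible haltingProblem A) :
    𝔠 ≤ #A := by
  by_contra! hA
  obtain ⟨M, hM⟩ := h
  obtain ⟨K, hK, hKA, hKM⟩ := exists_subfield M A
  obtain ⟨y, hy, x, hx, hyK, hxy⟩ :=
    exists_generic_pair (hK.trans_lt (max_lt hA aleph0_lt_continuum))
  choose u hu hux using exists_iterate_eq_abs_sub_le hx hy
  have hlim : Tendsto u atTop (𝓝 x) := by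
    rw [tendsto_iff_dist_tendsto_zero]
    refine squeeze_zero (fun _ => dist_nonneg) hux ?_
    simpa using (tendsto_pow_atTop_nhds_zero_of_lt_one (r := (1 / 2 : ℝ)) (by norm_num)
      (by norm_num)).const_mul (4 * Real.pi)
  have hL := genericAlong_of_tendsto hyK hxy hu hlim
  have hnot : orbitProgram.code ++ [y, x] ∉ haltingProblem := by
    rw [mem_haltingProblem_iff]
    intro hhalt
    obtain ⟨n, hn⟩ := exists_iterate_of_haltsOn hhalt
    -- If the `n`-th iterate of `x` were `y`, then `x` would be a root of this polynomial of degree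
    -- `2 ^ n` over `K[y]`.
    refine hxy ((iterPoly K n).map C - C X) ?_ ?_
    · intro h0
      have := congrArg natDegree h0
      rw [natDegree_sub_C, natDegree_map_eq_of_injective C_injective, natDegree_iterPoly,
        natDegree_zero] at this
      exact absurd this (by positivity)
    · rw [map_sub, evalPair_C_X, sub_eq_zero, ← hn, ← aeval_iterPoly K]
      simp only [evalPair, coe_eval₂RingHom, eval₂_map, aeval_def]
      congr 1
      ext k
      simp
  have hcode : ∀ a ∈ orbitProgram.code, a ∈ K := by
    intro a ha
    obtain ⟨n, rfl⟩ := natCast_of_mem_code_orbitProgram ha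
    exact natCast_mem K n
  have hev := ((hM _).2 hnot).eventually_zero hL hKA hKM hcode
  obtain ⟨n, hn⟩ := (eventually_map.1 (eventually_sup.1 hev).2).exists
  have hmem : orbitProgram.code ++ [y, u n] ∈ haltingProblem :=
    mem_haltingProblem_iff.2 (orbitProgram_haltsOn (hu n))
  simpa using hn.unique ((hM _).1 hmem)

end Cardinality

end BSS

theorem theorem6p1 (C : Set BSS.Tuple) :
    (BSS.Reducible BSS.haltingProblem C → Cardinal.mk C = 2 ^ Cardinal.aleph0) ∧
      (C.Countable → ¬ BSS.Reducible BSS.haltingProblem C) := by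
  refine ⟨fun h => ?_, fun hC h => ?_⟩
  · rw [Cardinal.two_power_aleph0]
    refine le_antisymm ((Cardinal.mk_set_le C).trans ?_) (BSS.continuum_le_mk_of_reducible h)
    rw [Cardinal.mk_list_eq_mk, Cardinal.mk_real]
  · exact (BSS.continuum_le_mk_of_reducible h).not_gt
      (hC.le_aleph0.trans_lt Cardinal.aleph0_lt_continuum)
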